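/- Let $\mathbb{E}_1,\mathbb{E}_2$ be finite-dimensional real inner product spaces. Let $K\subset\mathbb{E}_2$ be a closed convex cone (a nonempty closed convex set with $\lambda x\in K$ for all $\lambda\ge 0$, $x\in K$) such that $K\subset -K^\circ$, where $K^\circ=\{v\in\mathbb{E}_2 : \langle u,v\rangle\le 0 \text{ for all } u\in K\}$ is the polar cone. Let $F:\mathbb{E}_1\to\mathbb{E}_2\cup\{+\infty_\bullet\}$, where $+\infty_\bullet$ is a formal element adjoined to $\mathbb{E}_2$, and put $$\operatorname{dom}F=\{x: F(x)\in\mathbb{E}_2\},\quad \operatorname{gph}F=\{(x,F(x)) : x\in\operatorname{dom}F\},\quad \operatorname{rge}F=F(\operatorname{dom}F),$$ $$\operatorname{Epi}_K F=\{(x,y)\in\operatorname{dom}F\times\mathbb{E}_2 : y-F(x)\in K\}.$$ Suppose that $F$ is proper ($\operatorname{dom}F\ne\emptyset$), $K$-convex ($\operatorname{Epi}_K F$ is convex) and $K$-closed ($\operatorname{Epi}_K F$ is closed), and that $\operatorname{ri}K\subset\operatorname{rge}F$, where $\operatorname{ri}K$ is the relative interior of $K$. Suppose moreover that for every $u\in\operatorname{ri}K$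 there is a nonempty convex set $C^u\subset F^{-1}(\mathbb{R}_+u)=\{x\in\operatorname{dom}F : F(x)=tu \text{ for some } t\ge 0\}$ such that the function $f_u=\langle u,F\rangle+\delta_{C^u}:\mathbb{E}_1\to\mathbb{R}\cup\{+\infty\}$ has no affine majorant on its domain, i.e. there is no affine function $\varphi:\mathbb{E}_1\to\mathbb{R}$ with $f_u\le\varphi$ on $\operatorname{dom}f_u=\{x : f_u(x)<+\infty\}$. Here $\langle u,F\rangle(x)=\langle u,F(x)\rangle$ for $x\in\operatorname{dom}F$ and $+\infty$ otherwise, and $\delta_{C^u}$ is $0$ on $C^u$ and $+\infty$ elsewhere. Then $$\operatorname{Epi}_K F=\overline{\operatorname{conv}}(\operatorname{gph}F),$$ the closed convex hull of the graph of $F$ in $\mathbb{E}_1\times\mathbb{E}_2$. -/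

import Mathlib

open scoped Pointwise

namespace ConeVal

variable {E₁ E₂ : Type*}

/-! ### Cones -/

/-- A cone: a nonempty set that is closed under multiplication by nonnegative scalars. -/
def IsCone [AddCommGroup E₂] [Module ℝ E₂] (K : Set E₂) : Prop :=
  K.Nonempty ∧ ∀ r : ℝ, 0 ≤ r → ∀ x ∈ K, r • x ∈ K

/-- The polar cone `K° = {v | ⟪u, v⟫ ≤ 0 for all u ∈ K}`. -/
def polarCone [NormedAddCommGroup E₂] [InnerProductSpace ℝ E₂] (K : Set E₂) : Set E₂ :=
  {v | ∀ u ∈ K, inner ℝ u v ≤ 0}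

/-- The ray `ℝ₊ u = {t u | t ≥ 0}`. -/
def ray [AddCommGroup E₂] [Module ℝ E₂] (u : E₂) : Set E₂ :=
  {y | ∃ t : ℝ, 0 ≤ t ∧ y = t • u}

/-! ### Extended-vector-valued functions

A function `F : E₁ → E₂ ∪ {+∞}` is a map `E₁ → WithTop E₂`; the same encoding with `E₂ = ℝ` is used
for scalar functions with values in `ℝ ∪ {+∞}`. -/

/-- The domain of `F`: the points with a finite value. -/
def dom (F : E₁ → WithTop E₂) : Set E₁ := {x | F x ≠ ⊤}

/-- The graph of `F`, over its domain. -/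
def gph (F : E₁ → WithTop E₂) : Set (E₁ × E₂) := {p | F p.1 = (p.2 : WithTop E₂)}

/-- The range of `F`: its finite values. -/
def rge (F : E₁ → WithTop E₂) : Set E₂ := {y | ∃ x, F x = (y : WithTop E₂)}

/-- The inverse image `F⁻¹(S)` of a set `S ⊆ E₂` of finite values. -/
def invImage (F : E₁ → WithTop E₂) (S : Set E₂) : Set E₁ := {x | ∃ y ∈ S, F x = (y : WithTop E₂)}

/-- The `K`-epigraph `{(x, y) | x ∈ dom F, y - F x ∈ K}`. -/
def epi [AddCommGroup E₂] (K : Set E₂) (F : E₁ → WithTop E₂) : Set (E₁ × E₂) :=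
  {p | ∃ z : E₂, F p.1 = (z : WithTop E₂) ∧ p.2 - z ∈ K}

/-- `F` is proper: its domain is nonempty. -/
def IsProper (F : E₁ → WithTop E₂) : Prop := (dom F).Nonempty

/-- `F` is `K`-convex: its `K`-epigraph is convex. -/
def IsConvex [AddCommGroup E₁] [Module ℝ E₁] [AddCommGroup E₂] [Module ℝ E₂]
    (K : Set E₂) (F : E₁ → WithTop E₂) : Prop :=
  Convex ℝ (epi K F)

/-- `F` is `K`-closed: its `K`-epigraph is closed. -/
def IsClosedFun [TopologicalSpace E₁] [AddCommGroup E₂] [TopologicalSpace E₂]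
    (K : Set E₂) (F : E₁ → WithTop E₂) : Prop :=
  IsClosed (epi K F)

/-- The scalarization `⟨u, F⟩`, equal to `⟪u, F x⟫` on `dom F` and to `+∞` elsewhere. -/
noncomputable def scalarization [NormedAddCommGroup E₂] [InnerProductSpace ℝ E₂]
    (u : E₂) (F : E₁ → WithTop E₂) : E₁ → WithTop ℝ :=
  fun x => (F x).map (fun y : E₂ => inner ℝ u y)

open Classical in
/-- The indicator function `δ_C`, equal to `0` on `C` and to `+∞` elsewhere. -/
noncomputable def indicatorFun (C : Set E₁) : E₁ → WithTop ℝ :=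
  fun x => if x ∈ C then 0 else ⊤

/-- The affine function `φ` majorizes `f` on `dom f`. -/
def IsAffineMajorant [AddCommGroup E₁] [Module ℝ E₁]
    (φ : E₁ →ᵃ[ℝ] ℝ) (f : E₁ → WithTop ℝ) : Prop :=
  ∀ x ∈ dom f, f x ≤ (φ x : WithTop ℝ)

end ConeVal

open Set Filter Topology

/-! The epigraph is closed and convex and contains the graph, hence its closed convex hull.
Conversely, since `ri K` is dense in `K`, it suffices that the hull contains `(x, F x + u)` for
every `u ∈ ri K`. Otherwise a separating functional would be positive at `(0, u)`; on `C^u`, where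
`F = t u`, it would bound `t`, hence `⟨u, F⟩ = t ‖u‖²`, by an affine function
(`add_mem_closedConvexHull_gph`). -/

/-- The segment from a point of a convex set to a point of its intrinsic interior lies in the
intrinsic interior, except possibly for the first endpoint. -/
theorem Convex.lineMap_mem_intrinsicInterior {E : Type*} [NormedAddCommGroup E] [NormedSpace ℝ E]
    {K : Set E} (hK : Convex ℝ K) {k u : E} (hk : k ∈ K) (hu : u ∈ intrinsicInterior ℝ K)
    {t : ℝ} (ht₀ : 0 < t) (ht₁ : t ≤ 1) :
    AffineMap.lineMap k u t ∈ intrinsicInterior ℝ K := by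
  rw [mem_intrinsicInterior] at hu
  obtain ⟨u, hu, rfl⟩ := hu
  have hkA : k ∈ affineSpan ℝ K := subset_affineSpan ℝ K hk
  -- Inverse of the homothety with centre `k` and ratio `t`: it pulls a neighbourhood of `u` inside
  -- `K` back to one of the new point, which convexity places in `K`.
  let g : affineSpan ℝ K → affineSpan ℝ K := fun y =>
    ⟨AffineMap.lineMap k (y : E) t⁻¹, AffineMap.lineMap_mem _ hkA y.2⟩
  have hg : Continuous g := by
    refine Continuous.subtype_mk ?_ _
    simp only [AffineMap.lineMap_apply_module]
    fun_prop
  have hinv : ∀ y : E, AffineMap.lineMap k (AffineMap.lineMap k y t⁻¹ : E) t = y := by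
    intro y
    simp [ht₀.ne']
  let z : affineSpan ℝ K := ⟨AffineMap.lineMap k (u : E) t, AffineMap.lineMap_mem _ hkA u.2⟩
  have hgz : g z = u := by
    apply Subtype.ext
    simp [g, z, ht₀.ne']
  refine mem_intrinsicInterior.2 ⟨z, ?_, rfl⟩
  rw [mem_interior_iff_mem_nhds] at hu ⊢
  rw [← hgz] at hu
  filter_upwards [hg.continuousAt.preimage_mem_nhds hu] with y hy
  have hy' : (AffineMap.lineMap k (y : E) t⁻¹ : E) ∈ K := hy
  have := hK.lineMap_mem hk hy' ⟨ht₀.le, ht₁⟩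
  rwa [hinv] at this

namespace ConeVal

variable {E₁ E₂ : Type*}

theorem gph_subset_epi [AddCommGroup E₂] {K : Set E₂} (hK : (0 : E₂) ∈ K)
    (F : E₁ → WithTop E₂) : gph F ⊆ epi K F :=
  fun p hp => ⟨p.2, hp, by simpa using hK⟩

theorem IsCone.zero_mem [AddCommGroup E₂] [Module ℝ E₂] {K : Set E₂} (hK : IsCone K) :
    (0 : E₂) ∈ K := by
  obtain ⟨⟨x, hx⟩, h⟩ := hK
  simpa using h 0 le_rfl x hx

/-- If `⟨u, F⟩ + δ_C` has no affine majorant, where `F` maps `C` into the ray through `u`, then the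
closed convex hull of the graph of `F` recedes in the direction `(0, u)`. -/
theorem add_mem_closedConvexHull_gph
    [NormedAddCommGroup E₁] [NormedSpace ℝ E₁]
    [NormedAddCommGroup E₂] [InnerProductSpace ℝ E₂]
    {F : E₁ → WithTop E₂} {u : E₂} {C : Set E₁} (hC : C ⊆ invImage F (ray u))
    (hmaj : ¬ ∃ φ : E₁ →ᵃ[ℝ] ℝ, IsAffineMajorant φ (scalarization u F + indicatorFun C))
    {x : E₁} {z : E₂} (hx : F x = (z : WithTop E₂)) :
    (x, z + u) ∈ closedConvexHull ℝ (gph F) := by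
  by_contra hnot
  obtain ⟨f, c, hf, hc⟩ := geometric_hahn_banach_closed_point
    (convex_closedConvexHull (𝕜 := ℝ)) isClosed_closedConvexHull hnot
  have hgph : ∀ {a : E₁} {b : E₂}, F a = (b : WithTop E₂) → f (a, 0) + f (0, b) < c := by
    intro a b hab
    have := hf (a, b) (subset_closedConvexHull hab)
    rwa [← map_add, Prod.mk_add_mk, add_zero, zero_add]
  have hβ : 0 < f (0, u) := by
    have h₁ := hgph hx
    have h₂ : f (x, z + u) = f (x, 0) + f (0, z) + f (0, u) := by
      simp [← map_add]
    linarith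
  -- The majorant is `a ↦ ‖u‖² (c - f (a, 0)) / f (0, u)`, from solving `f (a, 0) + t f (0, u) < c`
  -- for `t`.
  refine hmaj ⟨-((‖u‖ ^ 2 / f (0, u)) •
      ((f : E₁ × E₂ →ₗ[ℝ] ℝ) ∘ₗ LinearMap.inl ℝ E₁ E₂).toAffineMap)
    + AffineMap.const ℝ E₁ (‖u‖ ^ 2 / f (0, u) * c), fun a ha => ?_⟩
  by_cases haC : a ∈ C
  · obtain ⟨_, ⟨t, -, rfl⟩, hFa⟩ := hC haC
    have h₁ := hgph hFa
    have h₂ : f (0, t • u) = t * f (0, u) := by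
      rw [← smul_eq_mul, ← map_smul, Prod.smul_mk, smul_zero]
    rw [h₂] at h₁
    have h₃ : (scalarization u F + indicatorFun C) a = ((t * ‖u‖ ^ 2 : ℝ) : WithTop ℝ) := by
      simp [scalarization, indicatorFun, haC, hFa, inner_smul_right]
    rw [h₃, WithTop.coe_le_coe]
    have h₄ : ‖u‖ ^ 2 / f (0, u) * (t * f (0, u)) ≤ ‖u‖ ^ 2 / f (0, u) * (c - f (a, 0)) :=
      mul_le_mul_of_nonneg_left (by linarith) (by positivity)
    have h₅ : ‖u‖ ^ 2 / f (0, u) * (t * f (0, u)) = t * ‖u‖ ^ 2 := by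
      field_simp
    simp only [AffineMap.coe_add, AffineMap.coe_neg, AffineMap.coe_smul, Pi.add_apply,
      Pi.neg_apply, Pi.smul_apply, LinearMap.coe_toAffineMap, LinearMap.comp_apply,
      LinearMap.inl_apply, ContinuousLinearMap.coe_coe, AffineMap.const_apply, smul_eq_mul]
    linarith
  · exact absurd (by simp [indicatorFun, haC]) ha

end ConeVal


theorem propositionp
    {E₁ E₂ : Type*}
    [NormedAddCommGroup E₁] [InnerProductSpace ℝ E₁] [FiniteDimensional ℝ E₁]
    [NormedAddCommGroup E₂] [InnerProductSpace ℝ E₂] [FiniteDimensional ℝ E₂]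
    (K : Set E₂) (hK_cone : ConeVal.IsCone K) (hK_closed : IsClosed K) (hK_convex : Convex ℝ K)
    (hK_polar : K ⊆ -ConeVal.polarCone K)
    (F : E₁ → WithTop E₂) (hF_proper : ConeVal.IsProper F)
    (hF_convex : ConeVal.IsConvex K F) (hF_closed : ConeVal.IsClosedFun K F)
    (hF_range : intrinsicInterior ℝ K ⊆ ConeVal.rge F)
    (hC : ∀ u ∈ intrinsicInterior ℝ K, ∃ C : Set E₁,
      C.Nonempty ∧ Convex ℝ C ∧ C ⊆ ConeVal.invImage F (ConeVal.ray u) ∧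
      ¬ ∃ φ : E₁ →ᵃ[ℝ] ℝ,
        ConeVal.IsAffineMajorant φ (ConeVal.scalarization u F + ConeVal.indicatorFun C)) :
    ConeVal.epi K F = closedConvexHull ℝ (ConeVal.gph F) := by
  refine Subset.antisymm ?_ (closedConvexHull_min
    (ConeVal.gph_subset_epi hK_cone.zero_mem F) hF_convex hF_closed)
  rintro ⟨x, y⟩ ⟨z, hz, hk⟩
  obtain ⟨u, hu⟩ := hK_cone.1.intrinsicInterior hK_convex
  -- Moving `y - z` slightly towards `u` puts it in `ri K`.
  have hlim : Tendsto (fun t : ℝ => (x, z + AffineMap.lineMap (y - z) u t)) (𝓝[>] 0)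
      (𝓝 (x, y)) := by
    have hcont : Continuous fun t : ℝ => (x, z + AffineMap.lineMap (y - z) u t) := by
      simp only [AffineMap.lineMap_apply_module]
      fun_prop
    have := (hcont.tendsto 0).mono_left (nhdsWithin_le_nhds (s := Ioi 0))
    simpa using this
  refine isClosed_closedConvexHull.mem_of_tendsto hlim ?_
  filter_upwards [Ioc_mem_nhdsGT (zero_lt_one' ℝ)] with t ht
  obtain ⟨C, -, -, hCF, hmaj⟩ := hC _ (hK_convex.lineMap_mem_intrinsicInterior hk hu ht.1 ht.2)
  exact ConeVal.add_mem_closedConvexHull_gph hCF hmaj hz
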